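/- Let $1\le k\le m$ be integers, let $N\subset\mathbf{R}^m$ be closed, and let $d_N(x)=\inf_{q\in N}|q-x|$ and $\pi_N(x)=\{q\in N : |q-x|=d_N(x)\}$. Let $\Sigma(N)\subset\mathbf{R}^m\setminus N$ be the set of points outside $N$ at which $d_N$ is not differentiable (equivalently, $\#\pi_N(x)\ge 2$), and for $j\ge 2$ let $\Sigma_j(N)=\{x\in\Sigma(N) : \#\pi_N(x)=j\}$. Suppose that $p\in\Sigma_{k+1}(N)$ and $\dim\operatorname{conv}(\pi_N(p))=k$, that is, the $k+1$ nearest points of $p$ are the vertices of a $k$-simplex. Then there is an $(m-k)$-dimensional DC submanifold $S$ of $\mathbf{R}^m$ such that $$p\in S\subset\Sigma(N)\setminus\bigcup_{j=2}^k\Sigma_j(N).$$ Here a continuous function on an open set $\Omega\subset\mathbf{R}^d$ is (locally) DC if on every open convex set $\Omega'$ with compact closure contained in $\Omega$ it is a difference of two convex functions; a map is DC if its components are; and a map on an open subset of a $d$-dimensional affine subspace is DC if it becomes DC after an isometric identification of the subspace with $\mathbf{R}^d$. For $1\le d\le m-1$, a set $S\subset\mathbf{R}^m$ is a $d$-dimensional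 DC submanifold if every $x\in S$ has an open neighborhood $U$ in $\mathbf{R}^m$ and a $d$-dimensional affine subspace $P$ such that the orthogonal projection $\pi:\mathbf{R}^m\to P$ is bi-Lipschitz on $S\cap U$, the image $\pi(S\cap U)$ is open in $P$, and the inverse map $\pi(S\cap U)\to S\cap U\subset\mathbf{R}^m$ is DC. A $0$-dimensional DC submanifold is a single point. -/

import Mathlib

/-- Continuous functions `u` on an open set `Ω ⊆ ℝᵈ` that are (locally) delta-convex: on every open
convex set compactly embedded in `Ω`, `u` is a difference of two convex functions.
Only the values of `u` on `Ω` matter. -/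
def IsLocallyDC {d : ℕ} (Ω : Set (EuclideanSpace ℝ (Fin d)))
    (u : EuclideanSpace ℝ (Fin d) → ℝ) : Prop :=
  ContinuousOn u Ω ∧
    ∀ Ω' : Set (EuclideanSpace ℝ (Fin d)), IsOpen Ω' → Convex ℝ Ω' →
      IsCompact (closure Ω') → closure Ω' ⊆ Ω →
      ∃ g₁ g₂ : EuclideanSpace ℝ (Fin d) → ℝ,
        ConvexOn ℝ Ω' g₁ ∧ ConvexOn ℝ Ω' g₂ ∧ ∀ x ∈ Ω', u x = g₁ x - g₂ x

/-- A map into `ℝⁿ` is (locally) DC when each of its components is. -/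
def IsLocallyDCMap {d n : ℕ} (Ω : Set (EuclideanSpace ℝ (Fin d)))
    (u : EuclideanSpace ℝ (Fin d) → EuclideanSpace ℝ (Fin n)) : Prop :=
  ∀ i : Fin n, IsLocallyDC Ω (fun x => u x i)

/-- A map on an open subset `W` of a `d`-dimensional affine subspace `P` is DC when it is so after
identifying `P` isometrically with `ℝᵈ`. -/
def IsDCMapOnAffine {m n : ℕ} (d : ℕ) (P : AffineSubspace ℝ (EuclideanSpace ℝ (Fin m)))
    [Nonempty P] (W : Set P) (f : P → EuclideanSpace ℝ (Fin n)) : Prop :=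
  ∃ T : EuclideanSpace ℝ (Fin d) ≃ᵃⁱ[ℝ] P, IsLocallyDCMap (T ⁻¹' W) (fun x => f (T x))

/-- The restriction of `f` to `A` is bi-Lipschitz. -/
def IsBiLipschitzOn {X Y : Type*} [PseudoMetricSpace X] [PseudoMetricSpace Y]
    (f : X → Y) (A : Set X) : Prop :=
  ∃ L : ℝ, 0 < L ∧ ∀ x ∈ A, ∀ y ∈ A,
    L⁻¹ * dist x y ≤ dist (f x) (f y) ∧ dist (f x) (f y) ≤ L * dist x y

/-- `d`-dimensional DC submanifolds of `ℝᵐ` (`0 ≤ d ≤ m - 1`). For `d ≥ 1`: around each point of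
`S`, the orthogonal projection `π` to some `d`-dimensional affine subspace `P` maps `S ∩ U`
bi-Lipschitzly onto an open subset of `P`, with a DC inverse `g : π(S ∩ U) → S ∩ U`.
A `0`-dimensional submanifold is a point. -/
def IsDCSubmanifold {m : ℕ} (d : ℕ) (S : Set (EuclideanSpace ℝ (Fin m))) : Prop :=
  (d = 0 ∧ ∃ x, S = {x}) ∨
  (1 ≤ d ∧ d + 1 ≤ m ∧ ∀ p ∈ S,
    ∃ U : Set (EuclideanSpace ℝ (Fin m)), IsOpen U ∧ p ∈ U ∧
    ∃ (P : AffineSubspace ℝ (EuclideanSpace ℝ (Fin m))) (_ : Nonempty P),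
      Module.finrank ℝ P.direction = d ∧
      IsOpen ((fun x => EuclideanGeometry.orthogonalProjection P x) '' (S ∩ U)) ∧
      IsBiLipschitzOn (fun x => EuclideanGeometry.orthogonalProjection P x) (S ∩ U) ∧
      ∃ g : P → EuclideanSpace ℝ (Fin m),
        (∀ x ∈ S ∩ U, g (EuclideanGeometry.orthogonalProjection P x) = x) ∧
        IsDCMapOnAffine d P
          ((fun x => EuclideanGeometry.orthogonalProjection P x) '' (S ∩ U)) g)

/-- The set `π_N(p)` of nearest points to `p` in `N`. -/
def nearestPoints {m : ℕ} (N : Set (EuclideanSpace ℝ (Fin m))) (p : EuclideanSpace ℝ (Fin m)) :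
    Set (EuclideanSpace ℝ (Fin m)) :=
  {q | q ∈ N ∧ Metric.infDist p N = dist q p}

/-- The singular set `Σ(N)`: the points outside `N` at which the distance function from `N` is
not differentiable. -/
def singularSet {m : ℕ} (N : Set (EuclideanSpace ℝ (Fin m))) : Set (EuclideanSpace ℝ (Fin m)) :=
  {p | p ∉ N ∧ ¬ DifferentiableAt ℝ (fun x => Metric.infDist x N) p}

/-- `Σ_j(N)`: the singular points with exactly `j` nearest points in `N`. -/
def singularSetCard {m : ℕ} (N : Set (EuclideanSpace ℝ (Fin m))) (j : ℕ) :
    Set (EuclideanSpace ℝ (Fin m)) :=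
  {p | p ∈ singularSet N ∧ (nearestPoints N p).encard = (j : ℕ∞)}

/-- The dimension of a (nonempty) convex set, i.e. of its affine hull. -/
noncomputable def convexDim {m : ℕ} (C : Set (EuclideanSpace ℝ (Fin m))) : ℕ :=
  Module.finrank ℝ (affineSpan ℝ C).direction

/-! Let `q 0, …, q k` be the nearest points of `p`, and let `d i` be the distance to the part of `N`
within `δ` of `q i`. Expanding the square gives `d i x ^ 2 = ‖x‖ ^ 2 - 2 * (e i x + ⟪x, q i⟫)` with
`e i` convex and `δ`-Lipschitz. Near `p` every nearest point lies in one of these pieces, so where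
all the `d i` agree, each piece contains a nearest point. This gives `k + 1` distinct ones.

Equality of the `d i` reads `⟪x, q i - q 0⟫ = e 0 x - e i x`, a Lipschitz-small perturbation of a
linear system of rank `k`. By contraction its solutions form a Lipschitz graph `G` over a space of
dimension `m - k` (`exists_graph_of_small_perturbation`).

The graph is DC because the Jensen gap of `G` is bounded by `C` times that of `h = (∑ i, e i) ∘ G`.
Hence `C * h` and each `G i + C * h` are convex (`isLocallyDCMap_comp_affineMap`). -/

open scoped RealInnerProductSpace

/-! ### Lipschitz-small perturbations of linear systems -/

section Graph

variable {E : Type*} [NormedAddCommGroup E] [InnerProductSpace ℝ E]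

theorem eq_zero_of_mem_span_of_inner_eq_zero {k : ℕ} {u : Fin k → E} {v : E}
    (hv : v ∈ Submodule.span ℝ (Set.range u)) (h : ∀ i, ⟪v, u i⟫ = 0) : v = 0 := by
  have h1 : v ∈ (Submodule.span ℝ (Set.range u))ᗮ := by
    rw [Submodule.mem_orthogonal']
    intro w hw
    induction hw using Submodule.span_induction with
    | mem x hx => obtain ⟨i, rfl⟩ := hx; exact h i
    | zero => simp
    | add x y _ _ hx hy => rw [inner_add_right, hx, hy, add_zero]
    | smul a x _ hx => rw [inner_smul_right, hx, mul_zero]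
  have := (Submodule.mem_orthogonal' _ _).1 h1 v hv
  simpa using this

/-- The inner products with a linearly independent family can be prescribed on its span. -/
theorem LinearIndependent.exists_inner_rightInverse {k : ℕ} {u : Fin k → E}
    (hu : LinearIndependent ℝ u) :
    ∃ B : (Fin k → ℝ) →ₗ[ℝ] E, (∀ y, B y ∈ Submodule.span ℝ (Set.range u)) ∧
      (∀ y i, ⟪B y, u i⟫ = y i) ∧
      ∀ v ∈ Submodule.span ℝ (Set.range u), B (fun i => ⟪v, u i⟫) = v := by
  let V := Submodule.span ℝ (Set.range u)
  let A : V →ₗ[ℝ] (Fin k → ℝ) := LinearMap.pi fun i => (innerₗ E (u i)).comp V.subtype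
  have hA : ∀ (v : V) i, A v i = ⟪(v : E), u i⟫ := fun v i => by
    simp [A, real_inner_comm]
  have hinj : Function.Injective A := by
    rw [← LinearMap.ker_eq_bot, LinearMap.ker_eq_bot']
    intro v hv
    apply Subtype.ext
    refine eq_zero_of_mem_span_of_inner_eq_zero v.2 fun i => ?_
    rw [← hA, hv]; rfl
  have hd : Module.finrank ℝ V = Module.finrank ℝ (Fin k → ℝ) := by
    rw [finrank_span_eq_card hu]; simp
  let e := LinearEquiv.ofInjectiveOfFinrankEq A hinj hd
  have he : ∀ v, e v = A v := fun v => rfl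
  refine ⟨V.subtype.comp e.symm.toLinearMap, fun y => (e.symm y).2, fun y i => ?_, fun v hv => ?_⟩
  · have := congrFun ((he (e.symm y)).symm.trans (e.apply_symm_apply y)) i
    rw [hA] at this
    exact this
  · have h1 : (fun i => ⟪v, u i⟫) = e ⟨v, hv⟩ := by
      funext i; rw [he, hA]
    rw [h1]
    simp

/-- The Jensen gap `a f(x) + b f(y) - f(a x + b y)`. -/
def jensenGap (f : E → ℝ) (a b : ℝ) (x y : E) : ℝ := a * f x + b * f y - f (a • x + b • y)

/-- The solution set of a Lipschitz-small perturbation `⟪x, u i⟫ = D i x` of a linear system is a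
Lipschitz graph `G` over the orthogonal complement of the span of the `u i`; if the Jensen gaps of
the `D i` are controlled by that of a Lipschitz-small function `e`, then those of `G` are controlled
by that of the convex function `e ∘ G`. -/
theorem exists_graph_of_small_perturbation [FiniteDimensional ℝ E] {k : ℕ} {u : Fin k → E} {V : Submodule ℝ E}
    (hV : V = Submodule.span ℝ (Set.range u))
    {B : (Fin k → ℝ) →ₗ[ℝ] E} (hBV : ∀ y, B y ∈ V) (hBu : ∀ y i, ⟪B y, u i⟫ = y i)
    (hBinv : ∀ v ∈ V, B (fun i => ⟪v, u i⟫) = v)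
    {c η : ℝ} (hc : 0 < c) (hη : 0 < η) (hBc : ∀ y, ‖B y‖ ≤ c * ‖y‖) (hcη : c * η ≤ 1 / 4)
    {D : Fin k → E → ℝ} {e : E → ℝ}
    (hD : ∀ i x y, |D i x - D i y| ≤ η * ‖x - y‖)
    (he : ∀ x y, |e x - e y| ≤ η * ‖x - y‖)
    (hJe : ∀ a b x y, 0 ≤ a → 0 ≤ b → a + b = 1 → 0 ≤ jensenGap e a b x y)
    (hJ : ∀ i a b x y, 0 ≤ a → 0 ≤ b → a + b = 1 →
      |jensenGap (D i) a b x y| ≤ jensenGap e a b x y) :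
    ∃ G : E → E, (∀ w i, ⟪G w, u i⟫ = D i (G w)) ∧ (∀ w, G w - w ∈ V) ∧
      (∀ x w, (∀ i, ⟪x, u i⟫ = D i x) → x - w ∈ V → G w = x) ∧
      (∀ w w', ‖G w - G w'‖ ≤ 2 * ‖w - w'‖) ∧
      ∃ C : ℝ, ∀ a b w w', 0 ≤ a → 0 ≤ b → a + b = 1 →
        ‖a • G w + b • G w' - G (a • w + b • w')‖ ≤ C * jensenGap (e ∘ G) a b w w' := by
  have huV : ∀ i, u i ∈ V := fun i => hV ▸ Submodule.subset_span ⟨i, rfl⟩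
  have hproj : ∀ w, w - Vᗮ.starProjection w ∈ V := fun w => by
    have := Submodule.sub_starProjection_mem_orthogonal (K := Vᗮ) w
    rwa [Submodule.orthogonal_orthogonal] at this
  have hprojmem : ∀ w, Vᗮ.starProjection w ∈ Vᗮ := fun w => Submodule.starProjection_apply_mem _ _
  have hpn : ∀ w, ‖Vᗮ.starProjection w‖ ≤ ‖w‖ := fun w => Submodule.norm_starProjection_apply_le _ _
  have hv : ∀ v ∈ V, ∀ M, 0 ≤ M → (∀ i, |⟪v, u i⟫| ≤ M) → ‖v‖ ≤ c * M := by
    intro v hv M hM h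
    rw [← hBinv v hv]
    refine (hBc _).trans (mul_le_mul_of_nonneg_left ?_ hc.le)
    exact (pi_norm_le_iff_of_nonneg hM).2 fun i => h i
  -- A fixed point of `Φ w` has the `Vᗮ`-component of `w`, and its `V`-component is the one the
  -- equations prescribe.
  let Φ : E → E → E := fun w x => Vᗮ.starProjection w + B fun i => D i x
  have hBD : ∀ x y, ‖(B fun i => D i x) - B fun i => D i y‖ ≤ 1 / 4 * ‖x - y‖ := by
    intro x y
    rw [← map_sub]
    refine (hBc _).trans ?_
    have : ‖(fun i => D i x) - fun i => D i y‖ ≤ η * ‖x - y‖ :=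
      (pi_norm_le_iff_of_nonneg (by positivity)).2 fun i => hD i x y
    calc c * _ ≤ c * (η * ‖x - y‖) := mul_le_mul_of_nonneg_left this hc.le
      _ = c * η * ‖x - y‖ := by ring
      _ ≤ _ := mul_le_mul_of_nonneg_right hcη (norm_nonneg _)
  have hΦ : ∀ w, ContractingWith (1 / 4) (Φ w) := by
    intro w
    refine ⟨by rw [← NNReal.coe_lt_coe]; norm_num, LipschitzWith.of_dist_le_mul fun x y => ?_⟩
    rw [dist_eq_norm, dist_eq_norm]
    simpa [Φ] using hBD x y
  let G : E → E := fun w => (hΦ w).fixedPoint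
  have hG : ∀ w, G w = Vᗮ.starProjection w + B fun i => D i (G w) :=
    fun w => ((hΦ w).fixedPoint_isFixedPt).symm
  have hGu : ∀ w i, ⟪G w, u i⟫ = D i (G w) := by
    intro w i
    conv_lhs => rw [hG w]
    rw [inner_add_left, hBu, Submodule.inner_left_of_mem_orthogonal (huV i) (hprojmem w), zero_add]
  have hGV : ∀ w, G w - w ∈ V := by
    intro w
    rw [hG w]
    have := V.sub_mem (hBV fun i => D i (G w)) (hproj w)
    convert this using 1; abel
  have hGuniq : ∀ x w, (∀ i, ⟪x, u i⟫ = D i x) → x - w ∈ V → G w = x := by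
    intro x w hx hxw
    have h1 : G w - x ∈ V := by
      convert V.sub_mem (hGV w) hxw using 1; abel
    have h2 := hv _ h1 (η * ‖G w - x‖) (by positivity) fun i => by
      rw [inner_sub_left, hGu, hx]; exact hD i _ _
    have h3 : c * (η * ‖G w - x‖) ≤ 1 / 4 * ‖G w - x‖ := by
      rw [← mul_assoc]; exact mul_le_mul_of_nonneg_right hcη (norm_nonneg _)
    have h4 : ‖G w - x‖ = 0 := by linarith [norm_nonneg (G w - x)]
    exact sub_eq_zero.1 (norm_eq_zero.1 h4)
  refine ⟨G, hGu, hGV, hGuniq, fun w w' => ?_, 2 * c, ?_⟩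
  · have h1 : G w - G w' = Vᗮ.starProjection (w - w') +
        ((B fun i => D i (G w)) - B fun i => D i (G w')) := by
      conv_lhs => rw [hG w, hG w']
      rw [map_sub]; abel
    have h2 := norm_add_le (Vᗮ.starProjection (w - w'))
      ((B fun i => D i (G w)) - B fun i => D i (G w'))
    rw [← h1] at h2
    linarith [hpn (w - w'), hBD (G w) (G w'), norm_nonneg (w - w')]
  · intro a b w w' ha hb hab
    set x := G w with hx
    set y := G w' with hy
    set z := G (a • w + b • w') with hz
    set t := a • x + b • y with ht
    have h1 : t - z ∈ V := by
      have := V.sub_mem (V.add_mem (V.smul_mem a (hGV w)) (V.smul_mem b (hGV w')))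
        (hGV (a • w + b • w'))
      convert this using 1
      rw [smul_sub, smul_sub, ht, hz]; abel
    -- The equations hold at `x`, `y` and `z` but not at `t`; the defect at `t` is a Jensen gap of
    -- `D i` plus a Lipschitz error. Replacing `e t` by `e z` costs a second such error. Both are
    -- absorbed since `2 * c * η ≤ 1 / 2`, whence the constant `2 * c`.
    have h2 := hv _ h1 (jensenGap e a b x y + η * ‖t - z‖)
      (add_nonneg (hJe a b x y ha hb hab) (by positivity)) fun i => by
        have h3 : ⟪t - z, u i⟫ = jensenGap (D i) a b x y + (D i t - D i z) := by
          rw [inner_sub_left, ht, inner_add_left, inner_smul_left, inner_smul_left, hx, hy, hz,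
            hGu, hGu, hGu, jensenGap]
          simp
        rw [h3]
        exact (abs_add_le _ _).trans (add_le_add (hJ i a b x y ha hb hab) (hD i _ _))
    have h4 : jensenGap e a b x y = jensenGap (e ∘ G) a b w w' + (e z - e t) := by
      simp only [jensenGap, Function.comp, hx, hy, hz, ht]; ring
    have h5 := (le_abs_self _).trans (he z t)
    rw [norm_sub_rev] at h5
    rw [h4] at h2
    have h6 : c * (jensenGap (e ∘ G) a b w w' + (e z - e t) + η * ‖t - z‖) ≤
        c * (jensenGap (e ∘ G) a b w w' + η * ‖t - z‖ + η * ‖t - z‖) := by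
      gcongr
    have h7 : c * η * ‖t - z‖ ≤ 1 / 4 * ‖t - z‖ :=
      mul_le_mul_of_nonneg_right hcη (norm_nonneg _)
    linarith

end Graph

/-! ### Local squared distances and nearest points -/

section Support

variable {E : Type*} [NormedAddCommGroup E] [InnerProductSpace ℝ E]

/-- The function `x ↦ max_{z ∈ K} (⟪x, z - q⟫ - ‖z‖² / 2)`, for `K` compact and close to `q`, is
convex and Lipschitz with a small constant. -/
theorem IsCompact.exists_max_inner_sub {K : Set E} (hK : IsCompact K) (hne : K.Nonempty)
    {q : E} {δ : ℝ} (hδ : ∀ z ∈ K, dist z q ≤ δ) :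
    ∃ e : E → ℝ, (∀ x, ∀ z ∈ K, ⟪x, z - q⟫ - ‖z‖ ^ 2 / 2 ≤ e x) ∧
      (∀ x, ∃ z ∈ K, ⟪x, z - q⟫ - ‖z‖ ^ 2 / 2 = e x) ∧
      (∀ x y, |e x - e y| ≤ δ * ‖x - y‖) ∧
      ∀ a b x y, 0 ≤ a → 0 ≤ b → a + b = 1 → 0 ≤ jensenGap e a b x y := by
  have h : ∀ x : E, ∃ z ∈ K, IsMaxOn (fun z => ⟪x, z - q⟫ - ‖z‖ ^ 2 / 2) K z := fun x =>
    hK.exists_isMaxOn hne (by fun_prop)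
  choose z hzK hz using h
  have hmax : ∀ x, ∀ y ∈ K, ⟪x, y - q⟫ - ‖y‖ ^ 2 / 2 ≤ ⟪x, z x - q⟫ - ‖z x‖ ^ 2 / 2 :=
    fun x y hy => hz x hy
  have hle : ∀ x y, (⟪x, z x - q⟫ - ‖z x‖ ^ 2 / 2) - (⟪y, z y - q⟫ - ‖z y‖ ^ 2 / 2) ≤
      δ * ‖x - y‖ := by
    intro x y
    have h1 := hmax y (z x) (hzK x)
    have h2 := real_inner_le_norm (x - y) (z x - q)
    have h3 : ‖z x - q‖ ≤ δ := by rw [← dist_eq_norm]; exact hδ _ (hzK x)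
    have h4 := mul_le_mul_of_nonneg_left h3 (norm_nonneg (x - y))
    rw [inner_sub_left] at h2
    linarith
  refine ⟨fun x => ⟪x, z x - q⟫ - ‖z x‖ ^ 2 / 2, hmax, fun x => ⟨z x, hzK x, rfl⟩,
    fun x y => abs_le.2 ⟨?_, hle x y⟩, fun a b x y ha hb hab => ?_⟩
  · have := hle y x
    rw [norm_sub_rev] at this
    linarith
  · simp only [jensenGap]
    set w := z (a • x + b • y)
    have h1 := mul_le_mul_of_nonneg_left (hmax x w (hzK _)) ha
    have h2 := mul_le_mul_of_nonneg_left (hmax y w (hzK _)) hb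
    rw [inner_add_left, inner_smul_left, inner_smul_left]
    simp only [conj_trivial]
    have h3 : ‖w‖ ^ 2 / 2 = a * (‖w‖ ^ 2 / 2) + b * (‖w‖ ^ 2 / 2) := by
      rw [← add_mul, hab, one_mul]
    linarith

/-- Points of a nonempty closed set close to realizing the distance from `p` are close to the
nearest points. -/
theorem IsClosed.exists_dist_lt_of_dist_le_infDist_add [FiniteDimensional ℝ E] {N : Set E}
    (hN : IsClosed N) (p : E) {δ : ℝ} (hδ : 0 < δ) :
    ∃ ε > 0, ∀ q ∈ N, dist q p ≤ Metric.infDist p N + ε →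
      ∃ q' ∈ N, Metric.infDist p N = dist q' p ∧ dist q q' < δ := by
  have : ProperSpace E := FiniteDimensional.proper ℝ E
  let O : Set E := ⋃ q' ∈ {q' | q' ∈ N ∧ Metric.infDist p N = dist q' p}, Metric.ball q' δ
  -- On this compact set of points far from all nearest points, the distance to `p` has a minimum
  -- exceeding `infDist p N`; half the excess serves as `ε`.
  let K : Set E := (N ∩ Metric.closedBall p (Metric.infDist p N + 1)) \ O
  have hO : IsOpen O := isOpen_biUnion fun _ _ => Metric.isOpen_ball
  have hK : IsCompact K := ((isCompact_closedBall p _).inter_left hN).diff hO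
  have hmem : ∀ q ∈ N, q ∉ K → dist q p ≤ Metric.infDist p N + 1 →
      ∃ q' ∈ N, Metric.infDist p N = dist q' p ∧ dist q q' < δ := by
    intro q hq hqK hd
    have : q ∈ O := by
      by_contra h
      exact hqK ⟨⟨hq, hd⟩, h⟩
    simp only [O, Set.mem_iUnion] at this
    obtain ⟨q', ⟨h1, h2⟩, h3⟩ := this
    exact ⟨q', h1, h2, h3⟩
  rcases K.eq_empty_or_nonempty with h0 | hne
  · exact ⟨1, one_pos, fun q hq hd => hmem q hq (by simp [h0]) hd⟩
  obtain ⟨y, hyK, hy⟩ := hK.exists_isMinOn hne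
    (f := fun q => dist q p) (by fun_prop)
  have hlt : Metric.infDist p N < dist y p := by
    refine lt_of_le_of_ne (by rw [dist_comm]; exact Metric.infDist_le_dist_of_mem hyK.1.1)
      fun h => hyK.2 ?_
    simp only [O, Set.mem_iUnion]
    exact ⟨y, ⟨hyK.1.1, h⟩, Metric.mem_ball_self hδ⟩
  refine ⟨min 1 ((dist y p - Metric.infDist p N) / 2), lt_min one_pos (by linarith),
    fun q hq hd => hmem q hq (fun hqK => ?_) (hd.trans (by gcongr; exact min_le_left _ _))⟩
  have h1 : dist y p ≤ dist q p := hy hqK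
  have h2 := min_le_right 1 ((dist y p - Metric.infDist p N) / 2)
  linarith

/-- The distance function is not differentiable at points with two nearest points. -/
theorem not_differentiableAt_infDist {N : Set E} {x q q' : E} (hq : q ∈ N) (hq' : q' ∈ N)
    (h : Metric.infDist x N = dist q x) (h' : Metric.infDist x N = dist q' x) (hne : q ≠ q') :
    ¬ DifferentiableAt ℝ (fun x => Metric.infDist x N) x := by
  intro hd
  set f := fun x => Metric.infDist x N with hf
  have hnorm : ‖fderiv ℝ f x‖ ≤ 1 := by
    have := norm_fderiv_le_of_lipschitz ℝ (x₀ := x) (Metric.lipschitz_infDist_pt N)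
    simpa using this
  -- Along the segment from `x` to a nearest point the distance decreases at unit speed.
  have key : ∀ q ∈ N, Metric.infDist x N = dist q x →
      fderiv ℝ f x (q - x) = - dist q x := by
    intro q hq h
    have h1 : HasDerivAt (fun t : ℝ => x + t • (q - x)) (q - x) 0 := by
      simpa using ((hasDerivAt_id (0 : ℝ)).smul_const (q - x)).const_add x
    have hd' : HasFDerivAt f (fderiv ℝ f x) (x + (0 : ℝ) • (q - x)) := by
      simpa using hd.hasFDerivAt
    have h2 : HasDerivAt (fun t : ℝ => f (x + t • (q - x))) (fderiv ℝ f x (q - x)) 0 :=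
      HasFDerivAt.comp_hasDerivAt (f := fun t : ℝ => x + t • (q - x)) 0 hd' h1
    have h3 : HasDerivAt (fun t : ℝ => (1 - t) * dist q x) (- dist q x) 0 := by
      simpa using ((hasDerivAt_id (0 : ℝ)).const_sub 1).mul_const (dist q x)
    have h4 : ∀ t ∈ Set.Ici (0 : ℝ) ∩ Set.Iic 1, f (x + t • (q - x)) = (1 - t) * dist q x := by
      rintro t ⟨ht0, ht1⟩
      have ht0' : (0 : ℝ) ≤ t := ht0
      have ht1' : t ≤ 1 := ht1
      apply le_antisymm
      · refine (Metric.infDist_le_dist_of_mem hq).trans (le_of_eq ?_)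
        rw [dist_eq_norm, dist_eq_norm, show x + t • (q - x) - q = (1 - t) • (x - q) by module,
          norm_smul, Real.norm_of_nonneg (by linarith), norm_sub_rev]
      · have h5 := Metric.infDist_le_infDist_add_dist (s := N) (x := x) (y := x + t • (q - x))
        have h6 : dist x (x + t • (q - x)) = t * dist q x := by
          rw [dist_eq_norm, dist_eq_norm, show x - (x + t • (q - x)) = (-t) • (q - x) by module,
            norm_smul, norm_neg, Real.norm_of_nonneg ht0']
        rw [h6, h] at h5
        simp only [hf]; linarith
    have h5 : HasDerivWithinAt (fun t : ℝ => f (x + t • (q - x))) (- dist q x) (Set.Icc 0 1) 0 :=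
      h3.hasDerivWithinAt.congr (fun t ht => h4 t ⟨ht.1, ht.2⟩)
        (h4 0 ⟨by simp, by simp⟩)
    exact (uniqueDiffOn_Icc_zero_one 0 (by simp)).eq_deriv _ h2.hasDerivWithinAt h5
  have k1 := key q hq h
  have k2 := key q' hq' h'
  have hdd : dist q x = dist q' x := h.symm.trans h'
  -- A derivative of norm at most `1` attaining full slope in both directions forces equality in the
  -- triangle inequality; the parallelogram law then gives `q = q'`.
  have hx : ‖(q - x) + (q' - x)‖ = ‖q - x‖ + ‖q' - x‖ := by
    refine le_antisymm (norm_add_le _ _) ?_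
    have h1 := (fderiv ℝ f x).le_of_opNorm_le hnorm ((q - x) + (q' - x))
    rw [map_add, k1, k2, one_mul, Real.norm_eq_abs] at h1
    rw [← dist_eq_norm, ← dist_eq_norm]
    have h2 := neg_abs_le (-dist q x + -dist q' x)
    linarith
  have hn : ‖q - x‖ = ‖q' - x‖ := by rw [← dist_eq_norm, ← dist_eq_norm, hdd]
  have hpar := parallelogram_law_with_norm ℝ (q - x) (q' - x)
  rw [hx, hn] at hpar
  have h0 : ‖(q - x) - (q' - x)‖ = 0 := by nlinarith
  rw [norm_eq_zero, sub_sub_sub_cancel_right, sub_eq_zero] at h0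
  exact hne h0

end Support

/-! ### DC regularity of graphs -/

/-- A continuous map whose Jensen gaps are controlled by those of a function is DC after composition
with any affine map. -/
theorem isLocallyDCMap_comp_affineMap {m d : ℕ}
    {G : EuclideanSpace ℝ (Fin m) → EuclideanSpace ℝ (Fin m)} (hG : Continuous G)
    {h : EuclideanSpace ℝ (Fin m) → ℝ} {C : ℝ}
    (hJ : ∀ a b w w', 0 ≤ a → 0 ≤ b → a + b = 1 →
      ‖a • G w + b • G w' - G (a • w + b • w')‖ ≤ C * jensenGap h a b w w')
    (A : EuclideanSpace ℝ (Fin d) →ᵃ[ℝ] EuclideanSpace ℝ (Fin m))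
    (Ω : Set (EuclideanSpace ℝ (Fin d))) : IsLocallyDCMap Ω fun x => G (A x) := by
  have hA : Continuous A := A.continuous_of_finiteDimensional
  have hT : ∀ (a b : ℝ) (x y : EuclideanSpace ℝ (Fin d)), a + b = 1 →
      A (a • x + b • y) = a • A x + b • A y := fun a b x y hab => Convex.combo_affine_apply hab
  refine fun i => ⟨Continuous.continuousOn (by fun_prop), fun Ω' _ hc _ _ =>
    ⟨fun x => G (A x) i + C * h (A x), fun x => C * h (A x), ⟨hc, ?_⟩, ⟨hc, ?_⟩,
      fun x _ => by ring⟩⟩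
  · intro x _ y _ a b ha hb hab
    have h1 := (PiLp.norm_apply_le (a • G (A x) + b • G (A y) - G (a • A x + b • A y)) i).trans
      (hJ a b (A x) (A y) ha hb hab)
    rw [Real.norm_eq_abs] at h1
    have h2 := (abs_le.1 h1).1
    simp only [jensenGap, PiLp.sub_apply, PiLp.add_apply, PiLp.smul_apply, smul_eq_mul] at h2
    simp only [hT a b x y hab, smul_eq_mul]
    linarith
  -- Convexity of `C * h` comes for free: its Jensen gap bounds a norm.
  · intro x _ y _ a b ha hb hab
    have h1 := (norm_nonneg _).trans (hJ a b (A x) (A y) ha hb hab)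
    simp only [jensenGap] at h1
    simp only [hT a b x y hab, smul_eq_mul]
    linarith

/-- A graph over a linear subspace whose Jensen gaps are controlled by those of a function is, inside
any open set, a DC submanifold. -/
theorem isDCSubmanifold_graph_inter {m d : ℕ} (hd : 1 ≤ d) (hdm : d + 1 ≤ m)
    {V : Submodule ℝ (EuclideanSpace ℝ (Fin m))} (hVd : Module.finrank ℝ Vᗮ = d)
    {G : EuclideanSpace ℝ (Fin m) → EuclideanSpace ℝ (Fin m)}
    {Z O : Set (EuclideanSpace ℝ (Fin m))} (hO : IsOpen O) (hGZ : ∀ w, G w ∈ Z)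
    (hGV : ∀ w, G w - w ∈ V) (hZ : ∀ x w, x ∈ Z → x - w ∈ V → G w = x)
    (hlip : ∀ w w', ‖G w - G w'‖ ≤ 2 * ‖w - w'‖)
    {h : EuclideanSpace ℝ (Fin m) → ℝ} {C : ℝ}
    (hJ : ∀ a b w w', 0 ≤ a → 0 ≤ b → a + b = 1 →
      ‖a • G w + b • G w' - G (a • w + b • w')‖ ≤ C * jensenGap h a b w w') :
    IsDCSubmanifold d (Z ∩ O) := by
  have hGc : Continuous G := by
    refine LipschitzWith.continuous (K := 2) (LipschitzWith.of_dist_le_mul fun x y => ?_)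
    rw [dist_eq_norm, dist_eq_norm]; exact hlip x y
  obtain ⟨P, hP, hdir⟩ : ∃ P : AffineSubspace ℝ (EuclideanSpace ℝ (Fin m)),
      Nonempty P ∧ P.direction = Vᗮ :=
    ⟨Vᗮ.toAffineSubspace, ⟨⟨0, Vᗮ.zero_mem⟩⟩, Submodule.toAffineSubspace_direction _⟩
  refine Or.inr ⟨hd, hdm, fun p _ => ⟨Set.univ, isOpen_univ, trivial, P, hP, ?_⟩⟩
  have hdir' : P.directionᗮ = V := by rw [hdir, Submodule.orthogonal_orthogonal]
  have hfr : Module.finrank ℝ P.direction = d := by rw [hdir, hVd]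
  have hpr : ∀ x, x - (EuclideanGeometry.orthogonalProjection P x : EuclideanSpace ℝ (Fin m)) ∈ V :=
    fun x => by
      rw [← hdir']
      exact EuclideanGeometry.vsub_orthogonalProjection_mem_direction_orthogonal P x
  have hGp : ∀ x ∈ Z, G (EuclideanGeometry.orthogonalProjection P x) = x :=
    fun x hx => hZ x _ hx (hpr x)
  have hpG : ∀ w : P, EuclideanGeometry.orthogonalProjection P (G w) = w := fun w => by
    apply Subtype.ext
    rw [EuclideanGeometry.coe_orthogonalProjection_eq_iff_mem]
    exact ⟨w.2, by rw [hdir']; exact hGV w⟩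
  have himg : (fun x => EuclideanGeometry.orthogonalProjection P x) '' (Z ∩ O ∩ Set.univ) =
      (fun w : P => G w) ⁻¹' O := by
    ext w
    constructor
    · rintro ⟨x, ⟨⟨hxZ, hxO⟩, -⟩, rfl⟩
      simpa [hGp x hxZ] using hxO
    · intro hw
      exact ⟨G w, ⟨⟨hGZ w, hw⟩, trivial⟩, hpG w⟩
  have hGPc : Continuous fun w : P => G w := hGc.comp continuous_subtype_val
  refine ⟨hfr, by rw [himg]; exact hO.preimage hGPc, ⟨2, two_pos, ?_⟩, fun w => G w,
    fun x hx => hGp x hx.1.1, ?_⟩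
  · intro x hx y hy
    constructor
    · have h1 := hlip (EuclideanGeometry.orthogonalProjection P x)
        (EuclideanGeometry.orthogonalProjection P y)
      rw [hGp x hx.1.1, hGp y hy.1.1, ← dist_eq_norm, ← dist_eq_norm] at h1
      rw [Subtype.dist_eq]
      linarith
    · have h1 : dist (EuclideanGeometry.orthogonalProjection P x)
          (EuclideanGeometry.orthogonalProjection P y) =
          ‖P.direction.orthogonalProjectionOnto (x - y)‖ := by
        rw [dist_eq_norm_vsub P.direction]
        exact congrArg norm ((EuclideanGeometry.orthogonalProjection P).toAffineMap.linearMap_vsub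
          x y).symm
      have h2 := P.direction.norm_orthogonalProjectionOnto_apply_le (x - y)
      rw [h1]
      rw [← dist_eq_norm] at h2
      linarith [dist_nonneg (x := x) (y := y)]
  · obtain ⟨T⟩ : Nonempty (EuclideanSpace ℝ (Fin d) ≃ᵃⁱ[ℝ] P) :=
      ⟨(LinearIsometryEquiv.toAffineIsometryEquiv
        ((stdOrthonormalBasis ℝ P.direction).reindex (finCongr hfr)).repr.symm).trans
        (AffineIsometryEquiv.vaddConst ℝ (Classical.arbitrary P))⟩
    let A : EuclideanSpace ℝ (Fin d) →ᵃ[ℝ] EuclideanSpace ℝ (Fin m) :=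
      P.subtype.comp T.toAffineEquiv.toAffineMap
    exact ⟨T, isLocallyDCMap_comp_affineMap hGc hJ A _⟩

/-! ### The simplex of nearest points and the main theorem -/

theorem exists_pos_forall_le_dist {ι X : Type*} [Finite ι] [MetricSpace X] {q : ι → X}
    (hq : Function.Injective q) : ∃ ρ > 0, ∀ i j, i ≠ j → ρ ≤ dist (q i) (q j) := by
  have h : ∀ᶠ ρ in nhdsWithin (0 : ℝ) (Set.Ioi 0), ∀ i j, i ≠ j → ρ ≤ dist (q i) (q j) := by
    rw [Filter.eventually_all]; intro i
    rw [Filter.eventually_all]; intro j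
    by_cases hij : i = j
    · simp [hij]
    · filter_upwards [Ioc_mem_nhdsGT (dist_pos.2 (hq.ne hij))] with ρ hρ _ using hρ.2
  obtain ⟨ρ, h1, h2⟩ := (h.and self_mem_nhdsWithin).exists
  exact ⟨ρ, h2, h1⟩

theorem exists_enum_linearIndependent {m k : ℕ} {Q : Set (EuclideanSpace ℝ (Fin m))}
    (hQ : Q.encard = ((k + 1 : ℕ) : ℕ∞)) (hdim : convexDim (convexHull ℝ Q) = k) :
    ∃ q : Fin (k + 1) → EuclideanSpace ℝ (Fin m), Function.Injective q ∧ Set.range q = Q ∧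
      LinearIndependent ℝ fun i : Fin k => q i.succ - q 0 := by
  have hfin := Set.finite_of_encard_eq_coe hQ
  have hcard : hfin.toFinset.card = k + 1 := by
    have := hfin.encard_eq_coe_toFinset_card
    rw [hQ] at this
    exact_mod_cast this.symm
  let f := (hfin.toFinset.equivFinOfCardEq hcard).symm
  let q : Fin (k + 1) → EuclideanSpace ℝ (Fin m) := fun i => f i
  have hr : Set.range q = Q := by
    ext x
    constructor
    · rintro ⟨i, rfl⟩
      exact hfin.mem_toFinset.1 (f i).2
    · intro hx
      exact ⟨f.symm ⟨x, hfin.mem_toFinset.2 hx⟩, by simp [q]⟩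
  refine ⟨q, Subtype.val_injective.comp f.injective, hr, ?_⟩
  rw [convexDim, affineSpan_convexHull, direction_affineSpan, ← hr] at hdim
  have hai : AffineIndependent ℝ q :=
    (affineIndependent_iff_finrank_vectorSpan_eq ℝ q (by simp)).2 hdim
  rw [affineIndependent_iff_linearIndependent_vsub ℝ q 0] at hai
  exact hai.comp (fun i : Fin k => (⟨i.succ, Fin.succ_ne_zero i⟩ : {x : Fin (k + 1) // x ≠ 0}))
    fun i j h => Fin.succ_injective _ (congrArg Subtype.val h)

theorem mainTheorem5 (m k : ℕ) (hk : 1 ≤ k) (hkm : k ≤ m)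
    (N : Set (EuclideanSpace ℝ (Fin m))) (hN : IsClosed N)
    (p : EuclideanSpace ℝ (Fin m)) (hp : p ∈ singularSetCard N (k + 1))
    (hdim : convexDim (convexHull ℝ (nearestPoints N p)) = k) :
    ∃ S : Set (EuclideanSpace ℝ (Fin m)),
      IsDCSubmanifold (m - k) S ∧ p ∈ S ∧
      S ⊆ singularSet N \ ⋃ j ∈ Set.Icc 2 k, singularSetCard N j := by
  have hpN : p ∉ N := hp.1.1
  rcases hkm.eq_or_lt with rfl | hlt
  · refine ⟨{p}, Or.inl ⟨by simp, p, rfl⟩, rfl, Set.singleton_subset_iff.2 ⟨hp.1, fun h => ?_⟩⟩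
    simp only [Set.mem_iUnion] at h
    obtain ⟨j, hj, h⟩ := h
    have h1 : ((j : ℕ) : ℕ∞) = ((k + 1 : ℕ) : ℕ∞) := h.2.symm.trans hp.2
    have h2 : j = k + 1 := by exact_mod_cast h1
    have := hj.2
    omega
  obtain ⟨q, hqinj, hqr, hli⟩ := exists_enum_linearIndependent hp.2 hdim
  have hqnear : ∀ i, q i ∈ N ∧ Metric.infDist p N = dist (q i) p := fun i => by
    have : q i ∈ nearestPoints N p := hqr ▸ Set.mem_range_self i
    exact this
  set u : Fin k → EuclideanSpace ℝ (Fin m) := fun i => q i.succ - q 0 with hu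
  obtain ⟨B, hBV, hBu, hBinv⟩ := hli.exists_inner_rightInverse
  set V := Submodule.span ℝ (Set.range u) with hV
  obtain ⟨c, hc, hBc⟩ : ∃ c > 0, ∀ y, ‖B y‖ ≤ c * ‖y‖ :=
    B.toContinuousLinearMap.bound
  obtain ⟨ρ, hρ, hsep⟩ := exists_pos_forall_le_dist hqinj
  -- The first bound keeps the `δ`-balls around the `q i` disjoint; the second gives the contraction
  -- condition for the Lipschitz constant `(k + 1) * δ` of `∑ i, e i`.
  set δ := min (ρ / 3) (1 / (4 * c * (k + 1))) with hδdef
  have hδ : 0 < δ := by positivity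
  have hδρ : δ ≤ ρ / 3 := min_le_left _ _
  have hcδ : c * ((k + 1) * δ) ≤ 1 / 4 := by
    calc c * ((k + 1) * δ) ≤ c * ((k + 1) * (1 / (4 * c * (k + 1)))) := by
          gcongr; exact min_le_right _ _
      _ = 1 / 4 := by field_simp
  obtain ⟨ε, hε, hnear⟩ := hN.exists_dist_lt_of_dist_le_infDist_add p hδ
  have hcpt : ∀ i, IsCompact (N ∩ Metric.closedBall (q i) δ) := fun i =>
    (isCompact_closedBall _ _).inter_left hN
  have hmemq : ∀ i, q i ∈ N ∩ Metric.closedBall (q i) δ := fun i =>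
    ⟨(hqnear i).1, Metric.mem_closedBall_self hδ.le⟩
  have hex := fun i => (hcpt i).exists_max_inner_sub ⟨q i, hmemq i⟩ (q := q i) (δ := δ)
    fun z hz => hz.2
  choose e hmax hatt hlip hJ using hex
  have hval : ∀ x z : EuclideanSpace ℝ (Fin m),
      dist z x ^ 2 = ‖x‖ ^ 2 - 2 * (⟪x, z⟫ - ‖z‖ ^ 2 / 2) := fun x z => by
    rw [dist_comm, dist_eq_norm, norm_sub_sq_real]; ring
  -- the maximum defining `e i` selects the points of `N` near `q i` closest to `x`
  have hmax' : ∀ i x z, z ∈ N → dist z (q i) ≤ δ →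
      ‖x‖ ^ 2 - dist z x ^ 2 ≤ 2 * (e i x + ⟪x, q i⟫) := fun i x z hz hd => by
    have := hmax i x z ⟨hz, hd⟩
    rw [inner_sub_right] at this
    rw [hval]; linarith
  have hatt' : ∀ i x, ∃ z ∈ N, dist z (q i) ≤ δ ∧
      ‖x‖ ^ 2 - dist z x ^ 2 = 2 * (e i x + ⟪x, q i⟫) := fun i x => by
    obtain ⟨z, ⟨hz, hd⟩, h⟩ := hatt i x
    refine ⟨z, hz, hd, ?_⟩
    rw [inner_sub_right] at h
    rw [hval]; linarith
  have hgap : ∀ (i : Fin k) a b x y, jensenGap (fun x => e 0 x - e i.succ x) a b x y =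
      jensenGap (e 0) a b x y - jensenGap (e i.succ) a b x y := fun i a b x y => by
    simp only [jensenGap]; ring
  have hgapsum : ∀ a b x y, jensenGap (fun x => ∑ i, e i x) a b x y =
      ∑ i, jensenGap (e i) a b x y := fun a b x y => by
    simp only [jensenGap, Finset.sum_sub_distrib, Finset.sum_add_distrib, Finset.mul_sum]
  have hk1 : (2 : ℝ) ≤ k + 1 := by
    have : (1 : ℝ) ≤ k := by exact_mod_cast hk
    linarith
  obtain ⟨G, hGu, hGV, hGuniq, hGlip, C, hGJ⟩ :=
    exists_graph_of_small_perturbation (V := V) (B := B) hV hBV hBu hBinv hc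
      (η := (k + 1) * δ) (by positivity) hBc hcδ
      (D := fun i x => e 0 x - e i.succ x) (e := fun x => ∑ i, e i x)
      (fun i x y => by
        have h1 := hlip 0 x y
        have h2 := hlip i.succ x y
        have h3 : 2 * (δ * ‖x - y‖) ≤ (k + 1) * (δ * ‖x - y‖) :=
          mul_le_mul_of_nonneg_right hk1 (by positivity)
        rw [abs_le] at h1 h2 ⊢
        constructor <;> linarith [h1.1, h1.2, h2.1, h2.2])
      (fun x y => by
        rw [← Finset.sum_sub_distrib]
        refine (Finset.abs_sum_le_sum_abs _ _).trans
          ((Finset.sum_le_sum fun i _ => hlip i x y).trans (le_of_eq ?_))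
        simp; ring)
      (fun a b x y ha hb hab => by
        rw [hgapsum]
        exact Finset.sum_nonneg fun i _ => hJ i a b x y ha hb hab)
      -- The gap of `e 0 - e i.succ` is a difference of two nonnegative terms of the sum.
      (fun i a b x y ha hb hab => by
        rw [hgapsum, hgap]
        have h1 : ∀ j, jensenGap (e j) a b x y ≤ ∑ j, jensenGap (e j) a b x y := fun j =>
          Finset.single_le_sum (f := fun j => jensenGap (e j) a b x y)
            (fun j _ => hJ j a b x y ha hb hab) (Finset.mem_univ j)
        rw [abs_le]
        constructor <;>
          linarith [h1 0, h1 i.succ, hJ 0 a b x y ha hb hab, hJ i.succ a b x y ha hb hab])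
  have hdpos : 0 < Metric.infDist p N :=
    (hN.notMem_iff_infDist_pos ⟨q 0, (hqnear 0).1⟩).1 hpN
  -- A nearest point of `x` is within `infDist p N + 2 * dist x p` of `p`, hence the `ε / 2`; the
  -- other bound keeps the ball off `N`.
  set r := min (ε / 2) (Metric.infDist p N) with hr
  have hr0 : 0 < r := by positivity
  have hfr : Module.finrank ℝ Vᗮ = m - k := by
    have h1 := Submodule.finrank_add_finrank_orthogonal V
    have h2 : Module.finrank ℝ V = k := by rw [hV, finrank_span_eq_card hli]; simp
    rw [h2, finrank_euclideanSpace_fin] at h1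
    omega
  refine ⟨{x | ∀ i : Fin k, ⟪x, u i⟫ = e 0 x - e i.succ x} ∩ Metric.ball p r,
    isDCSubmanifold_graph_inter (G := G) (by omega) (by omega) hfr Metric.isOpen_ball hGu hGV
      hGuniq hGlip hGJ, ⟨fun i => ?_, Metric.mem_ball_self hr0⟩, ?_⟩
  · have h1 : ∀ i, 2 * (e i p + ⟪p, q i⟫) = ‖p‖ ^ 2 - Metric.infDist p N ^ 2 := by
      intro i
      apply le_antisymm
      · obtain ⟨z, hz, -, h⟩ := hatt' i p
        rw [← h]
        have := Metric.infDist_le_dist_of_mem (x := p) hz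
        rw [dist_comm] at this
        gcongr
      · have := hmax' i p (q i) (hqnear i).1 (by simp [hδ.le])
        rwa [← (hqnear i).2] at this
    rw [hu, inner_sub_right]
    linarith [h1 0, h1 i.succ]
  · rintro x ⟨hxS, hxr⟩
    rw [Metric.mem_ball] at hxr
    have hxε : dist x p < ε / 2 := hxr.trans_le (min_le_left _ _)
    have heq : ∀ i, e i x + ⟪x, q i⟫ = e 0 x + ⟪x, q 0⟫ := by
      intro i
      refine Fin.cases rfl (fun i => ?_) i
      have := hxS i
      rw [hu, inner_sub_right] at this
      linarith
    obtain ⟨y, hyN, hy⟩ := hN.exists_infDist_eq_dist ⟨q 0, (hqnear 0).1⟩ x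
    obtain ⟨j, hj⟩ : ∃ j, dist y (q j) ≤ δ := by
      have h1 := Metric.infDist_le_infDist_add_dist (s := N) (x := x) (y := p)
      have h2 := dist_triangle y x p
      rw [dist_comm y x, ← hy] at h2
      obtain ⟨q', hq'N, hq', hd⟩ := hnear y hyN (by linarith)
      have h3 : q' ∈ Set.range q := by rw [hqr]; exact ⟨hq'N, hq'⟩
      obtain ⟨j, rfl⟩ := h3
      exact ⟨j, hd.le⟩
    choose z hzN hzd hz using fun i => hatt' i x
    -- The global minimizer `y` lies in piece `j`, and all pieces are equidistant from `x`.
    have hznear : ∀ i, Metric.infDist x N = dist (z i) x := by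
      intro i
      apply le_antisymm
      · rw [dist_comm]; exact Metric.infDist_le_dist_of_mem (hzN i)
      · have h1 := hmax' j x y hyN hj
        rw [heq j, ← heq i, ← hz i, dist_comm y x, ← hy] at h1
        exact le_of_sq_le_sq (by linarith) Metric.infDist_nonneg
    have hzinj : Function.Injective z := by
      intro i i' h
      by_contra hne
      have h1 := hsep i i' hne
      have h2 := dist_triangle_left (q i) (q i') (z i)
      have h3 := hzd i'
      rw [← h] at h3
      linarith [hzd i]
    have hxN : x ∉ N := fun hx => by
      have h1 := Metric.infDist_le_dist_of_mem (x := p) hx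
      rw [dist_comm] at h1
      linarith [min_le_right (ε / 2) (Metric.infDist p N)]
    refine ⟨⟨hxN, not_differentiableAt_infDist (hzN 0) (hzN ⟨1, by omega⟩) (hznear _) (hznear _)
      (hzinj.ne (by simp [Fin.ext_iff]))⟩, fun h => ?_⟩
    simp only [Set.mem_iUnion] at h
    obtain ⟨i, hi, -, h⟩ := h
    have h1 : Set.range z ⊆ nearestPoints N x := by
      rintro _ ⟨i, rfl⟩
      exact ⟨hzN i, hznear i⟩
    have h2 := Set.encard_le_encard h1
    rw [h, ← Set.image_univ, hzinj.encard_image, Set.encard_univ, ENat.card_eq_coe_fintype_card,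
      Fintype.card_fin] at h2
    have h3 : k + 1 ≤ i := by exact_mod_cast h2
    have := hi.2
    omega
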